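/- Let $s\ge q>1$, $b>0$ and $A>0$. There is a constant $C>0$, depending only on $b,A,q,s$, such that the following holds. Let $d,n\ge 1$ be integers and let $\mathcal X$ be a measurable space with at least $\lfloor\log_2(2d)\rfloor$ points, any two distinct points of which are separated by a measurable set. Then there is a set $\mathcal G$ of exactly $d$ measurable functions $g:\mathcal X\to\mathbb R$ with $\sup_{x\in\mathcal X}|g(x)|\le b$, such that for every (deterministic or randomized) estimator $\hat g$, which maps a sample $Z_1^n=((X_1,Y_1),\dots,(X_n,Y_n))\in(\mathcal X\times\mathbb R)^n$ measurably to a (possibly random) prediction function $\mathcal X\to\mathbb R$, there is a probability distribution $P$ on $\mathcal X\times\mathbb R$ with $\mathbb E_{(X,Y)\sim P}|Y|^s\le A$ for which both inequalities $$\mathbb E R(\hat g)-\min_{g\in\mathcal G}R(g)\ \ge\ C\Big(\frac{\log|\mathcal G|}{n}\wedge 1\Big)^{1-(q-1)/s}$$ and $$\mathbb E R(\hat g)-\min_{g\in\mathcal G}R(g)\ \ge\ C\Big(\frac{\log|\mathcal G|}{n}\wedge 1\Big)^{1-q/(s+2)}$$ hold. Here $R(g)=\mathbb E_{(X,Y)\sim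 P}|Y-g(X)|^q$, $R(g)$ is finite for every $g\in\mathcal G$, and $\mathbb E R(\hat g)\in[0,\infty]$ is the expectation of the risk of $\hat g$ over a sample $Z_1^n\sim P^{\otimes n}$ and over the randomization of $\hat g$, if any. -/

import Mathlib

open MeasureTheory ProbabilityTheory
open scoped ENNReal

universe u v

namespace LqRegression

/-- A possibly randomized estimator based on a training sample of size `n` with inputs in `X` and
real outputs. Given the sample `z`, a parameter `ω` is drawn from the probability distribution
`law z`, and the prediction function `predict z ω : X → ℝ` is used. Nothing is assumed about the
predictions, except joint measurability. -/
structure Estimator (X : Type u) [MeasurableSpace X] (n : ℕ) where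
  /-- the space of the auxiliary random parameter -/
  Param : Type v
  [measurableSpaceParam : MeasurableSpace Param]
  /-- the distribution of the auxiliary parameter, given the sample -/
  law : Kernel (Fin n → X × ℝ) Param
  [isMarkovKernel_law : IsMarkovKernel law]
  /-- the prediction function that is selected -/
  predict : (Fin n → X × ℝ) → Param → X → ℝ
  measurable_predict :
    Measurable fun p : (Fin n → X × ℝ) × Param × X => predict p.1 p.2.1 p.2.2

attribute [instance] Estimator.measurableSpaceParam Estimator.isMarkovKernel_law

/-- The risk `R(g) = E |Y - g(X)|^q` for `(X, Y)` of law `P`, as an element of `[0, ∞]`. -/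
noncomputable def risk {X : Type u} [MeasurableSpace X] (q : ℝ) (P : Measure (X × ℝ))
    (g : X → ℝ) : ℝ≥0∞ :=
  ∫⁻ z, ENNReal.ofReal (|z.2 - g z.1| ^ q) ∂P

/-- The expected risk `E R(ĝ)` of an estimator trained on `n` independent draws from `P`, the
expectation being over the sample and over the randomization. It may be infinite. -/
noncomputable def Estimator.expectedRisk {X : Type u} [MeasurableSpace X] {n : ℕ}
    (e : Estimator.{u, v} X n) (q : ℝ) (P : Measure (X × ℝ)) : ℝ≥0∞ :=
  ∫⁻ z, ∫⁻ ω, risk q P (e.predict z ω) ∂(e.law z) ∂(Measure.pi fun _ : Fin n => P)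

/-- A deterministic estimator: a measurable map from samples to prediction functions. -/
noncomputable def Estimator.deterministic {X : Type u} [MeasurableSpace X] {n : ℕ}
    (f : (Fin n → X × ℝ) → X → ℝ)
    (hf : Measurable fun p : (Fin n → X × ℝ) × X => f p.1 p.2) : Estimator.{u, v} X n where
  Param := PUnit
  law := Kernel.const _ (Measure.dirac PUnit.unit)
  predict := fun z _ => f z
  measurable_predict := hf.comp (measurable_fst.prodMk measurable_snd.snd)

/-- For a deterministic estimator the expected risk is the usual one. -/
theorem Estimator.expectedRisk_deterministic {X : Type u} [MeasurableSpace X] {n : ℕ}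
    (f : (Fin n → X × ℝ) → X → ℝ)
    (hf : Measurable fun p : (Fin n → X × ℝ) × X => f p.1 p.2) (q : ℝ)
    (P : Measure (X × ℝ)) :
    (Estimator.deterministic.{u, v} f hf).expectedRisk q P =
      ∫⁻ z, risk q P (f z) ∂(Measure.pi fun _ : Fin n => P) := by
  refine lintegral_congr fun z => ?_
  change ∫⁻ _ : PUnit.{v + 1}, risk q P (f z) ∂(Measure.dirac PUnit.unit) = _
  simp

end LqRegression

/-! The proof is Assouad's hypercube method. Put x = k/n with k = min(log₂ d, n). The input falls in
one of k cells, each a single point of mass w, or at a rest point where the output is 0. In cell j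
the output follows one of two laws, chosen by the bit σ j, with optimal predictions b and -b. The
2^k ≤ d functions with these optimal values form the class, after padding to size d, so its best
risk is at most k w v, where v is the optimal cell loss. Flipping one bit changes the law of a
sample so little that no estimator recovers the bit reliably (`exists_le_sum_of_affinity`). As every
prediction has excess at least γ on average over the two cell laws, some vertex forces an excess of
k w γ / 4 (`exists_cubeLaw_le_expectedRisk`). Predictions are unrestricted, so leaving the class
does not help.

Two choices of the cell laws give the two rates. Heavy outputs are 0 except for a value ±B of small
probability: γ has constant order and kw is of order x^(1-(q-1)/s). Biased outputs are ±B with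
nearly equal probabilities: γ is of order B^q (b/B)², and kw is of order x^(s/(s+2)). In both, B is
taken as large as the moment bound allows. Since x ≤ 1, the smaller exponent gives the stronger
bound, so a single law yields both inequalities. -/

namespace LqRegression

/-! ### Le Cam's inequality and Assouad's lemma -/

section Assouad

/-- Le Cam's inequality: since PQ = min(P, Q) · max(P, Q), Cauchy–Schwarz applies, and the maxima
sum to at most 2. -/
theorem sq_sum_sqrt_mul_le {Z : Type*} [Fintype Z] (P Q : Z → ℝ) (hP : ∀ z, 0 ≤ P z)
    (hQ : ∀ z, 0 ≤ Q z) (hP1 : ∑ z, P z = 1) (hQ1 : ∑ z, Q z = 1) :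
    (∑ z, √(P z * Q z)) ^ 2 ≤ 2 * ∑ z, min (P z) (Q z) := by
  have hm : ∀ z, 0 ≤ min (P z) (Q z) := fun z => le_min (hP z) (hQ z)
  have hM : ∀ z, 0 ≤ max (P z) (Q z) := fun z => (hP z).trans (le_max_left _ _)
  have h1 : ∑ z, √(P z * Q z) ≤ √(∑ z, min (P z) (Q z)) * √(∑ z, max (P z) (Q z)) := by
    refine le_trans (le_of_eq ?_) (Real.sum_sqrt_mul_sqrt_le _ hm hM)
    refine Finset.sum_congr rfl fun z _ => ?_
    rw [← Real.sqrt_mul (hm z), min_mul_max]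
  have h2 : ∑ z, max (P z) (Q z) ≤ 2 := by
    calc ∑ z, max (P z) (Q z) ≤ ∑ z, (P z + Q z) :=
          Finset.sum_le_sum fun z _ => max_le (by linarith [hQ z]) (by linarith [hP z])
      _ = 2 := by rw [Finset.sum_add_distrib, hP1, hQ1]; norm_num
  have hms : 0 ≤ ∑ z, min (P z) (Q z) := Finset.sum_nonneg fun z _ => hm z
  calc (∑ z, √(P z * Q z)) ^ 2
      ≤ (√(∑ z, min (P z) (Q z)) * √(∑ z, max (P z) (Q z))) ^ 2 :=
        pow_le_pow_left₀ (Finset.sum_nonneg fun z _ => Real.sqrt_nonneg _) h1 2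
    _ = (∑ z, min (P z) (Q z)) * ∑ z, max (P z) (Q z) := by
        rw [mul_pow, Real.sq_sqrt hms, Real.sq_sqrt (Finset.sum_nonneg fun z _ => hM z)]
    _ ≤ 2 * ∑ z, min (P z) (Q z) := by
        rw [mul_comm]; exact mul_le_mul_of_nonneg_right h2 hms

theorem sum_sqrt_prod_mul_prod {T : Type*} [Fintype T] (n : ℕ) (p q : T → ℝ)
    (hp : ∀ t, 0 ≤ p t) (hq : ∀ t, 0 ≤ q t) :
    ∑ z : Fin n → T, √((∏ i, p (z i)) * ∏ i, q (z i)) = (∑ t, √(p t * q t)) ^ n := by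
  rw [Fintype.sum_pow]
  refine Finset.sum_congr rfl fun z _ => ?_
  rw [← Finset.prod_mul_distrib, Real.sqrt_prod _ fun i _ => mul_nonneg (hp _) (hq _)]

/-- Flipping the coordinate `j` of a vertex of the hypercube. -/
def flipCoord {k : ℕ} (j : Fin k) (σ : Fin k → Bool) : Fin k → Bool :=
  Function.update σ j (!σ j)

theorem flipCoord_involutive {k : ℕ} (j : Fin k) : Function.Involutive (flipCoord j) := by
  intro σ
  simp [flipCoord]

/-- **Assouad's lemma** for finitely supported laws, in terms of Hellinger affinities. -/
theorem exists_le_sum_of_affinity {k n : ℕ} {T : Type*} [Fintype T] (p : (Fin k → Bool) → T → ℝ)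
    (hp : ∀ σ t, 0 ≤ p σ t) (hp1 : ∀ σ, ∑ t, p σ t = 1)
    (a : (Fin n → T) → Fin k → Bool → ℝ) (ha : ∀ z j β, 0 ≤ a z j β) {γ κ : ℝ} (hγ : 0 ≤ γ)
    (hγa : ∀ z j, 2 * γ ≤ a z j true + a z j false)
    (hκ : ∀ σ j, κ ≤ (∑ t, √(p σ t * p (flipCoord j σ) t)) ^ (2 * n)) :
    ∃ σ, k * (γ * κ / 2) ≤ ∑ z : Fin n → T, (∏ i, p σ (z i)) * ∑ j, a z j (σ j) := by
  have hP0 : ∀ σ (z : Fin n → T), 0 ≤ ∏ i, p σ (z i) := fun σ z =>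
    Finset.prod_nonneg fun i _ => hp _ _
  have hP1 : ∀ σ, ∑ z : Fin n → T, ∏ i, p σ (z i) = 1 := fun σ => by
    rw [← Fintype.sum_pow, hp1, one_pow]
  -- Two-point testing: on the common part of the two sample laws the losses for the two values of
  -- bit j add up to at least 2γ. The exponent 2n comes from tensorizing the affinity over n draws
  -- and then squaring it.
  have hpair : ∀ j σ, γ * κ ≤ (∑ z : Fin n → T, (∏ i, p σ (z i)) * a z j (σ j)) +
      ∑ z : Fin n → T, (∏ i, p (flipCoord j σ) (z i)) * a z j (flipCoord j σ j) := by
    intro j σ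
    have h1 := sq_sum_sqrt_mul_le _ _ (hP0 σ) (hP0 (flipCoord j σ)) (hP1 _) (hP1 _)
    rw [sum_sqrt_prod_mul_prod n _ _ (hp _) (hp _), ← pow_mul, mul_comm n 2] at h1
    have h2 := (hκ σ j).trans h1
    calc γ * κ ≤ γ * (2 * ∑ z : Fin n → T,
          min (∏ i, p σ (z i)) (∏ i, p (flipCoord j σ) (z i))) :=
          mul_le_mul_of_nonneg_left h2 hγ
      _ = ∑ z : Fin n → T,
          min (∏ i, p σ (z i)) (∏ i, p (flipCoord j σ) (z i)) * (2 * γ) := by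
          rw [← Finset.sum_mul]; ring
      _ ≤ _ := by
          rw [← Finset.sum_add_distrib]
          refine Finset.sum_le_sum fun z _ => ?_
          have h3 : 2 * γ ≤ a z j (σ j) + a z j (flipCoord j σ j) := by
            have := hγa z j
            cases h : σ j <;> simp [flipCoord, h] <;> linarith
          calc _ ≤ min (∏ i, p σ (z i)) (∏ i, p (flipCoord j σ) (z i)) *
                (a z j (σ j) + a z j (flipCoord j σ j)) :=
                mul_le_mul_of_nonneg_left h3 (le_min (hP0 _ _) (hP0 _ _))
            _ ≤ _ := by
                rw [mul_add]
                exact add_le_add (mul_le_mul_of_nonneg_right (min_le_left _ _) (ha _ _ _))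
                  (mul_le_mul_of_nonneg_right (min_le_right _ _) (ha _ _ _))
  -- Flipping bit j permutes the cube, so both halves of the paired bound have the same sum over σ.
  have hcoord : ∀ j, ∑ _σ : Fin k → Bool, γ * κ / 2 ≤
      ∑ σ : Fin k → Bool, ∑ z : Fin n → T, (∏ i, p σ (z i)) * a z j (σ j) := by
    intro j
    have h1 := Finset.sum_le_sum fun σ (_ : σ ∈ (Finset.univ : Finset (Fin k → Bool))) => hpair j σ
    rw [Finset.sum_add_distrib] at h1
    have h2 := Equiv.sum_comp (flipCoord_involutive j).toPerm
      fun σ => ∑ z : Fin n → T, (∏ i, p σ (z i)) * a z j (σ j)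
    simp only [Function.Involutive.coe_toPerm] at h2
    rw [h2] at h1
    rw [← Finset.sum_div]
    linarith
  obtain ⟨σ, -, hσ⟩ := Finset.exists_le_of_sum_le (s := (Finset.univ : Finset (Fin k → Bool)))
    (f := fun _ => k * (γ * κ / 2))
    (g := fun σ => ∑ z : Fin n → T, (∏ i, p σ (z i)) * ∑ j, a z j (σ j)) Finset.univ_nonempty (by
      have h1 := Finset.sum_le_sum fun j (_ : j ∈ (Finset.univ : Finset (Fin k))) => hcoord j
      simp only [Finset.sum_const, Finset.card_univ, nsmul_eq_mul, Fintype.card_fin] at h1 ⊢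
      refine (le_of_eq (by ring)).trans (h1.trans (le_of_eq ?_))
      rw [Finset.sum_comm]
      refine Finset.sum_congr rfl fun σ _ => ?_
      rw [Finset.sum_comm]
      simp only [Finset.mul_sum])
  exact ⟨σ, hσ⟩

end Assouad

/-! ### Finitely supported laws -/

section FiniteLaw

variable {T : Type*} [Fintype T] [MeasurableSpace T] [DiscreteMeasurableSpace T]

/-- The law on a finite type with the weights `p`. -/
noncomputable def finiteLaw (p : T → ℝ) : Measure T :=
  ∑ t, ENNReal.ofReal (p t) • Measure.dirac t

theorem lintegral_finiteLaw (p : T → ℝ) (f : T → ℝ≥0∞) :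
    ∫⁻ t, f t ∂(finiteLaw p) = ∑ t, ENNReal.ofReal (p t) * f t := by
  simp [finiteLaw]

theorem isProbabilityMeasure_finiteLaw {p : T → ℝ} (hp : ∀ t, 0 ≤ p t) (hp1 : ∑ t, p t = 1) :
    IsProbabilityMeasure (finiteLaw p) := by
  constructor
  rw [← lintegral_one, lintegral_finiteLaw]
  simp only [mul_one]
  rw [← ENNReal.ofReal_sum_of_nonneg fun t _ => hp t, hp1, ENNReal.ofReal_one]

theorem finiteLaw_singleton (p : T → ℝ) (t : T) : finiteLaw p {t} = ENNReal.ofReal (p t) := by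
  classical
  rw [← lintegral_indicator_one (measurableSet_singleton t), lintegral_finiteLaw]
  simp [Set.indicator_apply]

theorem lintegral_pi_map_finiteLaw {Ω : Type*} [MeasurableSpace Ω] {n : ℕ} {p : T → ℝ}
    (hp : ∀ t, 0 ≤ p t) (hp1 : ∑ t, p t = 1) (τ : T → Ω) {f : (Fin n → Ω) → ℝ≥0∞}
    (hf : Measurable f) :
    ∫⁻ z, f z ∂(Measure.pi fun _ : Fin n => (finiteLaw p).map τ) =
      ∑ z : Fin n → T, ENNReal.ofReal (∏ i, p (z i)) * f fun i => τ (z i) := by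
  classical
  have := isProbabilityMeasure_finiteLaw hp hp1
  have hτ : Measurable τ := .of_discrete
  have : IsProbabilityMeasure ((finiteLaw p).map τ) :=
    Measure.isProbabilityMeasure_map hτ.aemeasurable
  rw [← Measure.pi_map_pi fun _ => hτ.aemeasurable,
    lintegral_map hf .of_discrete,
    lintegral_fintype]
  refine Finset.sum_congr rfl fun z _ => ?_
  rw [Measure.pi_singleton, mul_comm, ENNReal.ofReal_prod_of_nonneg fun i _ => hp _]
  simp only [finiteLaw_singleton]

end FiniteLaw

/-! ### Building the function class -/

section Functions

theorem exists_injective_option_fin {X : Type*} {k : ℕ} (h : ((k + 1 : ℕ) : ℕ∞) ≤ ENat.card X) :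
    ∃ pt : Option (Fin k) → X, Function.Injective pt := by
  cases finite_or_infinite X with
  | inl hX =>
    have := Fintype.ofFinite X
    rw [ENat.card_eq_coe_fintype_card, Nat.cast_le] at h
    obtain ⟨f⟩ := Function.Embedding.nonempty_of_card_le (α := Option (Fin k)) (β := X)
      (by simpa using h)
    exact ⟨f, f.injective⟩
  | inr hX =>
    exact ⟨_, (Infinite.natEmbedding X).injective.comp
      (Encodable.encode_injective (α := Option (Fin k)))⟩

theorem exists_measurable_bounded_extension {X ι : Type*} [MeasurableSpace X]
    [MeasurableSpace.SeparatesPoints X] [Fintype ι] {pt : ι → X} (hpt : Function.Injective pt)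
    (v : ι → ℝ) {b : ℝ} (hv : ∀ i, |v i| ≤ b) (hb : 0 ≤ b) :
    ∃ g : X → ℝ, Measurable g ∧ (∀ x, |g x| ≤ b) ∧ ∀ i, g (pt i) = v i := by
  classical
  have hsep : ∀ i j : ι, ∃ S : Set X, MeasurableSet S ∧ pt i ∈ S ∧ (i ≠ j → pt j ∉ S) := by
    intro i j
    by_cases hij : i = j
    · exact ⟨Set.univ, .univ, trivial, fun h => (h hij).elim⟩
    · obtain ⟨S, h1, h2, h3⟩ := MeasurableSpace.exists_measurableSet_of_ne (hpt.ne hij)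
      exact ⟨S, h1, h2, fun _ => h3⟩
  choose S hS hmem hnot using hsep
  -- Each set contains its own point and none of the others. The sets may still overlap elsewhere,
  -- hence the truncation to [-b, b] below.
  set C : ι → Set X := fun i => ⋂ j, S i j with hC
  have hCm : ∀ i, MeasurableSet (C i) := fun i => .iInter fun j => hS i j
  refine ⟨fun x => max (-b) (min b (∑ i, (C i).indicator (fun _ => v i) x)), ?_, ?_, ?_⟩
  · exact measurable_const.max (measurable_const.min
      (Finset.measurable_sum _ fun i _ => measurable_const.indicator (hCm i)))
  · intro x
    rw [abs_le]
    exact ⟨le_max_left _ _, max_le (by linarith) (min_le_left _ _)⟩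
  · intro j
    have : ∑ i, (C i).indicator (fun _ => v i) (pt j) = v j := by
      rw [Finset.sum_eq_single j]
      · exact Set.indicator_of_mem (Set.mem_iInter.2 fun l => hmem j l) _
      · intro i _ hij
        exact Set.indicator_of_notMem (fun h => hnot i j hij (Set.mem_iInter.1 h j)) _
      · simp
    have h := abs_le.1 (hv j)
    simp only [this, min_eq_right h.2, max_eq_right h.1]

/-- Padding to cardinality exactly d is possible because the constants in [0, b] already give
infinitely many candidates. Extra functions can only lower the best risk in the class, which is
harmless. -/
theorem exists_finset_bounded_measurable {X ι : Type*} [MeasurableSpace X] [Nonempty X]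
    [Fintype ι] (f : ι → X → ℝ) {b : ℝ} (hb : 0 < b) (hf : ∀ i, Measurable (f i))
    (hfb : ∀ i x, |f i x| ≤ b) {d : ℕ} (hd : Fintype.card ι ≤ d) :
    ∃ G : Finset (X → ℝ), G.card = d ∧ (∀ g ∈ G, Measurable g ∧ ∀ x, |g x| ≤ b) ∧
      ∀ i, f i ∈ G := by
  classical
  let F := {g : X → ℝ // Measurable g ∧ ∀ x, |g x| ≤ b}
  have : Infinite (Set.Icc 0 b) := (Set.Icc_infinite hb).to_subtype
  have : Infinite F := by
    refine Infinite.of_injective (fun c : Set.Icc 0 b =>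
      (⟨fun _ => c, measurable_const, fun _ => ?_⟩ : F)) ?_
    · rw [abs_of_nonneg c.2.1]; exact c.2.2
    · intro c c' h
      exact Subtype.ext (congrFun (Subtype.ext_iff.1 h) (Classical.arbitrary X))
  obtain ⟨G, hG, hGd⟩ := Infinite.exists_superset_card_eq
    (Finset.univ.image fun i => (⟨f i, hf i, hfb i⟩ : F)) d (Finset.card_image_le.trans hd)
  refine ⟨G.map (Function.Embedding.subtype _), by rw [Finset.card_map, hGd], ?_, fun i => ?_⟩
  · intro g hg
    obtain ⟨g, -, rfl⟩ := Finset.mem_map.1 hg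
    exact g.2
  · exact Finset.mem_map.2 ⟨_, hG (Finset.mem_image_of_mem _ (Finset.mem_univ i)), rfl⟩

end Functions

/-! ### Hypercube weights and their affinities -/

section Cube

variable {X : Type u} {S : Type*} {k : ℕ}

/-- The expected `L^q` loss of the prediction `t` for an output with values `y` and weights `μ`. -/
noncomputable def cellLoss [Fintype S] (q : ℝ) (y μ : S → ℝ) (t : ℝ) : ℝ :=
  ∑ s, μ s * |y s - t| ^ q

/-- The weights of the hypercube law at the vertex `σ`: each of the `k` cells has mass `w`, and
the output in the cell `j` has the weights `ν (σ j)`. -/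
def cubeWeight (k : ℕ) (w : ℝ) (ν : Bool → S → ℝ) (σ : Fin k → Bool) : Option (Fin k × S) → ℝ
  | none => 1 - k * w
  | some (j, s) => w * ν (σ j) s

/-- The input-output pairs that carry the hypercube laws. -/
def cubePoint (pt : Option (Fin k) → X) (y : S → ℝ) : Option (Fin k × S) → X × ℝ
  | none => (pt none, 0)
  | some (j, s) => (pt (some j), y s)

/-- The value `h` or `-h`. -/
def signed (h : ℝ) (β : Bool) : ℝ := if β then h else -h

variable {w : ℝ} {ν : Bool → S → ℝ}

theorem cubeWeight_nonneg (hw : 0 ≤ w) (hkw : k * w ≤ 1) (hν : ∀ β s, 0 ≤ ν β s)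
    (σ : Fin k → Bool) (t : Option (Fin k × S)) : 0 ≤ cubeWeight k w ν σ t := by
  match t with
  | none => exact sub_nonneg.2 hkw
  | some (j, s) => exact mul_nonneg hw (hν _ _)

variable [Fintype S]

theorem sum_cubeWeight_mul (σ : Fin k → Bool) (f : Option (Fin k × S) → ℝ) :
    ∑ t, cubeWeight k w ν σ t * f t =
      (1 - k * w) * f none + w * ∑ j, ∑ s, ν (σ j) s * f (some (j, s)) := by
  rw [Fintype.sum_option, Fintype.sum_prod_type]
  simp only [cubeWeight, mul_assoc, Finset.mul_sum]

theorem sum_cubeWeight (hν1 : ∀ β, ∑ s, ν β s = 1) (σ : Fin k → Bool) :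
    ∑ t, cubeWeight k w ν σ t = 1 := by
  have := sum_cubeWeight_mul (w := w) (ν := ν) σ fun _ => 1
  simp only [mul_one, hν1, Finset.sum_const, Finset.card_univ, Fintype.card_fin,
    nsmul_eq_mul] at this
  rw [this]; ring

/-- Neighbouring vertices differ only in cell j. All other cells and the rest point contribute their
full mass, so the affinity defect is that of one cell, scaled by w. -/
theorem affinity_cubeWeight (hw : 0 ≤ w) (hkw : k * w ≤ 1) (hν : ∀ β s, 0 ≤ ν β s)
    (hν1 : ∀ β, ∑ s, ν β s = 1) (σ : Fin k → Bool) (j : Fin k) :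
    ∑ t, √(cubeWeight k w ν σ t * cubeWeight k w ν (flipCoord j σ) t) =
      1 - w * (1 - ∑ s, √(ν true s * ν false s)) := by
  have hcell : ∀ i, ∑ s, √(w * ν (σ i) s * (w * ν (flipCoord j σ i) s)) =
      w + if i = j then w * ((∑ s, √(ν true s * ν false s)) - 1) else 0 := by
    intro i
    have h1 : ∀ s, √(w * ν (σ i) s * (w * ν (flipCoord j σ i) s)) =
        w * √(ν (σ i) s * ν (flipCoord j σ i) s) := by
      intro s
      rw [mul_mul_mul_comm, Real.sqrt_mul (mul_nonneg hw hw), Real.sqrt_mul_self hw]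
    simp only [h1, ← Finset.mul_sum]
    split_ifs with hij
    · subst hij
      cases hs : σ i
      · simp only [flipCoord, hs, Function.update_self, Bool.not_false, mul_comm (ν false _)]
        ring
      · simp only [flipCoord, hs, Function.update_self, Bool.not_true]
        ring
    · simp only [flipCoord, Function.update_of_ne hij, Real.sqrt_mul_self (hν _ _), hν1]
      ring
  rw [Fintype.sum_option, Fintype.sum_prod_type]
  simp only [cubeWeight, hcell, Real.sqrt_mul_self (sub_nonneg.2 hkw), Finset.sum_add_distrib,
    Finset.sum_const, Finset.card_univ, Fintype.card_fin, nsmul_eq_mul, Finset.sum_ite_eq',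
    Finset.mem_univ, if_true]
  ring

end Cube

/-- Passes from losses in [0, ∞] to the real excesses that Assouad's lemma needs. If some loss is
infinite, the whole 2γ is charged to it. -/
theorem exists_excess {v γ : ℝ} (hγ : 0 ≤ γ) {E : Bool → ℝ≥0∞}
    (hE : ∀ β, ENNReal.ofReal v ≤ E β)
    (hsum : ENNReal.ofReal (2 * (v + γ)) ≤ E true + E false) :
    ∃ a : Bool → ℝ, (∀ β, 0 ≤ a β) ∧ 2 * γ ≤ a true + a false ∧
      ∀ β, ENNReal.ofReal (v + a β) ≤ E β := by
  by_cases hfin : ∀ β, E β ≠ ∞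
  · have hle : ∀ β, v ≤ (E β).toReal := fun β => (ENNReal.ofReal_le_iff_le_toReal (hfin β)).1 (hE β)
    refine ⟨fun β => (E β).toReal - v, fun β => sub_nonneg.2 (hle β), ?_, fun β => ?_⟩
    · rw [ENNReal.ofReal_le_iff_le_toReal (ENNReal.add_ne_top.2 ⟨hfin _, hfin _⟩),
        ENNReal.toReal_add (hfin _) (hfin _)] at hsum
      linarith
    · rw [add_sub_cancel, ENNReal.ofReal_toReal (hfin β)]
  · push Not at hfin
    obtain ⟨β₀, h₀⟩ := hfin
    refine ⟨fun β => if β = β₀ then 2 * γ else 0, fun β => ?_, ?_, fun β => ?_⟩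
    · dsimp only; split_ifs <;> linarith
    · cases β₀ <;> simp
    · dsimp only
      split_ifs with h
      · rw [h, h₀]; exact le_top
      · rw [add_zero]; exact hE β

/-! ### From Assouad's lemma to the expected risk -/

section LowerBound

variable {X : Type u} [MeasurableSpace X] {S : Type*} [Fintype S] {k n : ℕ} {w : ℝ}
  {ν : Bool → S → ℝ}

theorem measurable_risk_predict {q : ℝ} (P : Measure (X × ℝ)) [SFinite P]
    (e : Estimator.{u, v} X n) :
    Measurable fun z => ∫⁻ ω, risk q P (e.predict z ω) ∂(e.law z) := by
  refine Measurable.lintegral_kernel_prod_right (f := fun z ω => risk q P (e.predict z ω)) ?_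
  refine Measurable.lintegral_prod_right' (f := fun r : ((Fin n → X × ℝ) × e.Param) × X × ℝ =>
    ENNReal.ofReal (|r.2.2 - e.predict r.1.1 r.1.2 r.2.1| ^ q)) ?_
  have h : Measurable fun r : ((Fin n → X × ℝ) × e.Param) × X × ℝ =>
      e.predict r.1.1 r.1.2 r.2.1 :=
    e.measurable_predict.comp (by fun_prop :
      Measurable fun r : ((Fin n → X × ℝ) × e.Param) × X × ℝ => (r.1.1, r.1.2, r.2.1))
  have h2 : Measurable fun r : ((Fin n → X × ℝ) × e.Param) × X × ℝ =>
      |r.2.2 - e.predict r.1.1 r.1.2 r.2.1| :=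
    continuous_abs.measurable.comp ((by fun_prop : Measurable fun r :
      ((Fin n → X × ℝ) × e.Param) × X × ℝ => r.2.2).sub h)
  exact (h2.pow_const q).ennreal_ofReal

/-- The hypercube law at the vertex `σ`. -/
noncomputable def cubeLaw (pt : Option (Fin k) → X) (y : S → ℝ) (w : ℝ) (ν : Bool → S → ℝ)
    (σ : Fin k → Bool) : Measure (X × ℝ) :=
  letI : MeasurableSpace (Option (Fin k × S)) := ⊤
  (finiteLaw (cubeWeight k w ν σ)).map (cubePoint pt y)

theorem lintegral_cubeLaw (pt : Option (Fin k) → X) (y : S → ℝ) (hw : 0 ≤ w)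
    (hkw : k * w ≤ 1) (hν : ∀ β s, 0 ≤ ν β s) (σ : Fin k → Bool) {f : X × ℝ → ℝ}
    (hf : Measurable f) (hf0 : ∀ x, 0 ≤ f x) :
    ∫⁻ x, ENNReal.ofReal (f x) ∂(cubeLaw pt y w ν σ) =
      ENNReal.ofReal ((1 - k * w) * f (pt none, 0) +
        w * ∑ j, ∑ s, ν (σ j) s * f (pt (some j), y s)) := by
  let : MeasurableSpace (Option (Fin k × S)) := ⊤
  have : DiscreteMeasurableSpace (Option (Fin k × S)) := ⟨fun _ => trivial⟩
  rw [cubeLaw, lintegral_map hf.ennreal_ofReal .of_discrete, lintegral_finiteLaw]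
  have h0 := cubeWeight_nonneg hw hkw hν σ
  simp only [← ENNReal.ofReal_mul (h0 _)]
  rw [← ENNReal.ofReal_sum_of_nonneg fun t _ => mul_nonneg (h0 t) (hf0 _),
    sum_cubeWeight_mul σ fun t => f (cubePoint pt y t)]
  rfl

theorem isProbabilityMeasure_cubeLaw (pt : Option (Fin k) → X) (y : S → ℝ) (hw : 0 ≤ w)
    (hkw : k * w ≤ 1) (hν : ∀ β s, 0 ≤ ν β s) (hν1 : ∀ β, ∑ s, ν β s = 1) (σ : Fin k → Bool) :
    IsProbabilityMeasure (cubeLaw pt y w ν σ) := by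
  let : MeasurableSpace (Option (Fin k × S)) := ⊤
  have : DiscreteMeasurableSpace (Option (Fin k × S)) := ⟨fun _ => trivial⟩
  have := isProbabilityMeasure_finiteLaw (cubeWeight_nonneg hw hkw hν σ)
    (sum_cubeWeight (w := w) hν1 σ)
  exact Measure.isProbabilityMeasure_map (Measurable.of_discrete).aemeasurable

theorem risk_cubeLaw (pt : Option (Fin k) → X) (y : S → ℝ) (hw : 0 ≤ w)
    (hkw : k * w ≤ 1) (hν : ∀ β s, 0 ≤ ν β s) (σ : Fin k → Bool) (q : ℝ) {g : X → ℝ}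
    (hg : Measurable g) :
    risk q (cubeLaw pt y w ν σ) g =
      ENNReal.ofReal ((1 - k * w) * |g (pt none)| ^ q +
        w * ∑ j, cellLoss q y (ν (σ j)) (g (pt (some j)))) := by
  rw [risk, lintegral_cubeLaw pt y hw hkw hν σ (f := fun z => |z.2 - g z.1| ^ q)
    (by fun_prop) fun _ => by positivity]
  simp [cellLoss]

theorem exists_cubeLaw_le_expectedRisk {q : ℝ} (pt : Option (Fin k) → X) (y : S → ℝ)
    (hw : 0 ≤ w) (hkw : k * w ≤ 1) (hν : ∀ β s, 0 ≤ ν β s) (hν1 : ∀ β, ∑ s, ν β s = 1)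
    {v γ : ℝ} (hv : 0 ≤ v) (hγ : 0 ≤ γ) (hmin : ∀ β t, v ≤ cellLoss q y (ν β) t)
    (hgap : ∀ t, 2 * (v + γ) ≤ cellLoss q y (ν true) t + cellLoss q y (ν false) t)
    (haff : 1 / 2 ≤ (1 - w * (1 - ∑ s, √(ν true s * ν false s))) ^ (2 * n))
    (e : Estimator.{u, v} X n) :
    ∃ σ, ENNReal.ofReal (k * w * v + k * w * (γ / 4)) ≤
      e.expectedRisk q (cubeLaw pt y w ν σ) := by
  let : MeasurableSpace (Option (Fin k × S)) := ⊤
  have : DiscreteMeasurableSpace (Option (Fin k × S)) := ⟨fun _ => trivial⟩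
  have h0 := cubeWeight_nonneg (k := k) hw hkw hν
  have h1 := sum_cubeWeight (k := k) (w := w) hν1
  have hloss0 : ∀ β t, 0 ≤ cellLoss q y (ν β) t := fun β t => hv.trans (hmin β t)
  have hpred : ∀ z x, Measurable fun ω => e.predict z ω x := fun z x =>
    e.measurable_predict.comp (by fun_prop : Measurable fun ω => (z, ω, x))
  have hlossm : ∀ β, Measurable (cellLoss q y (ν β)) := fun β =>
    Finset.measurable_sum _ fun s _ => by fun_prop
  have hcm : ∀ β z x, Measurable fun ω => ENNReal.ofReal (cellLoss q y (ν β) (e.predict z ω x)) :=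
    fun β z x => ((hlossm β).comp (hpred z x)).ennreal_ofReal
  let τ : Option (Fin k × S) → X × ℝ := cubePoint pt y
  -- The randomization is integrated out with the sample fixed. Both `hmin` and `hgap` hold for
  -- every prediction, so they survive this averaging.
  let E : (Fin n → Option (Fin k × S)) → Fin k → Bool → ℝ≥0∞ := fun z j β =>
    ∫⁻ ω, ENNReal.ofReal (cellLoss q y (ν β) (e.predict (fun i => τ (z i)) ω (pt (some j))))
      ∂(e.law fun i => τ (z i))
  have hex : ∀ z j, ∃ a : Bool → ℝ, (∀ β, 0 ≤ a β) ∧ 2 * γ ≤ a true + a false ∧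
      ∀ β, ENNReal.ofReal (v + a β) ≤ E z j β := by
    intro z j
    refine exists_excess hγ (fun β => ?_) ?_
    · calc ENNReal.ofReal v = ∫⁻ _, ENNReal.ofReal v ∂(e.law fun i => τ (z i)) := by simp
        _ ≤ _ := lintegral_mono fun ω => ENNReal.ofReal_le_ofReal (hmin _ _)
    · calc ENNReal.ofReal (2 * (v + γ))
          = ∫⁻ _, ENNReal.ofReal (2 * (v + γ)) ∂(e.law fun i => τ (z i)) := by simp
        _ ≤ _ := by
          rw [← lintegral_add_left (hcm _ _ _)]
          refine lintegral_mono fun ω => ?_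
          rw [← ENNReal.ofReal_add (hloss0 _ _) (hloss0 _ _)]
          exact ENNReal.ofReal_le_ofReal (hgap _)
  choose a ha0 haγ hale using hex
  obtain ⟨σ, hσ⟩ := exists_le_sum_of_affinity (n := n) (cubeWeight k w ν) h0 h1 a ha0 hγ haγ
    (κ := 1 / 2) (fun σ j => by rw [affinity_cubeWeight hw hkw hν hν1]; exact haff)
  refine ⟨σ, ?_⟩
  have := isProbabilityMeasure_cubeLaw pt y hw hkw hν hν1 σ
  have hrisk : ∀ z, ENNReal.ofReal (w * ∑ j, (v + a z j (σ j))) ≤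
      ∫⁻ ω, risk q (cubeLaw pt y w ν σ) (e.predict (fun i => τ (z i)) ω)
        ∂(e.law fun i => τ (z i)) := by
    intro z
    calc ENNReal.ofReal (w * ∑ j, (v + a z j (σ j)))
        = ENNReal.ofReal w * ∑ j, ENNReal.ofReal (v + a z j (σ j)) := by
          rw [ENNReal.ofReal_mul hw,
            ENNReal.ofReal_sum_of_nonneg fun j _ => add_nonneg hv (ha0 _ _ _)]
      _ ≤ ENNReal.ofReal w * ∑ j, E z j (σ j) := by
          gcongr with j _
          exact hale z j (σ j)
      _ = ∫⁻ ω, ENNReal.ofReal w * ∑ j, ENNReal.ofReal (cellLoss q y (ν (σ j))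
            (e.predict (fun i => τ (z i)) ω (pt (some j)))) ∂(e.law fun i => τ (z i)) := by
          rw [lintegral_const_mul _ (Finset.measurable_sum _ fun j _ => hcm _ _ _),
            lintegral_finsetSum _ fun j _ => hcm _ _ _]
      _ ≤ _ := by
          refine lintegral_mono fun ω => ?_
          rw [risk_cubeLaw pt y hw hkw hν σ q (g := e.predict (fun i => τ (z i)) ω)
            (e.measurable_predict.comp
            (by fun_prop : Measurable fun x => ((fun i => τ (z i)), ω, x))),
            ← ENNReal.ofReal_sum_of_nonneg fun j _ => hloss0 _ _, ← ENNReal.ofReal_mul hw]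
          -- The loss at the rest point is nonnegative and is dropped.
          exact ENNReal.ofReal_le_ofReal
            (le_add_of_nonneg_left (mul_nonneg (sub_nonneg.2 hkw) (by positivity)))
  have hP0 : ∀ z : Fin n → Option (Fin k × S), 0 ≤ ∏ i, cubeWeight k w ν σ (z i) := fun z =>
    Finset.prod_nonneg fun i _ => h0 _ _
  have hP1 : ∑ z : Fin n → Option (Fin k × S), ∏ i, cubeWeight k w ν σ (z i) = 1 := by
    rw [← Fintype.sum_pow, h1, one_pow]
  have hmain : e.expectedRisk q (cubeLaw pt y w ν σ) =
      ∑ z : Fin n → Option (Fin k × S), ENNReal.ofReal (∏ i, cubeWeight k w ν σ (z i)) *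
        ∫⁻ ω, risk q (cubeLaw pt y w ν σ) (e.predict (fun i => τ (z i)) ω)
          ∂(e.law fun i => τ (z i)) :=
    lintegral_pi_map_finiteLaw (h0 σ) (h1 σ) τ (measurable_risk_predict _ e)
  rw [hmain]
  calc ENNReal.ofReal (k * w * v + k * w * (γ / 4))
      ≤ ENNReal.ofReal (∑ z : Fin n → Option (Fin k × S), (∏ i, cubeWeight k w ν σ (z i)) *
          (w * ∑ j, (v + a z j (σ j)))) := by
        refine ENNReal.ofReal_le_ofReal ?_
        have : ∑ z : Fin n → Option (Fin k × S), (∏ i, cubeWeight k w ν σ (z i)) *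
            (w * ∑ j, (v + a z j (σ j))) = k * w * v + w * ∑ z : Fin n → Option (Fin k × S),
              (∏ i, cubeWeight k w ν σ (z i)) * ∑ j, a z j (σ j) := by
          simp only [Finset.sum_add_distrib, Finset.sum_const, Finset.card_univ, Fintype.card_fin,
            nsmul_eq_mul, mul_add]
          rw [← Finset.sum_mul, hP1, Finset.mul_sum]
          congr 1
          · ring
          · exact Finset.sum_congr rfl fun z _ => by ring
        rw [this]
        have := mul_le_mul_of_nonneg_left hσ hw
        linarith
    _ = ∑ z : Fin n → Option (Fin k × S), ENNReal.ofReal (∏ i, cubeWeight k w ν σ (z i)) *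
          ENNReal.ofReal (w * ∑ j, (v + a z j (σ j))) := by
        rw [ENNReal.ofReal_sum_of_nonneg fun z _ => mul_nonneg (hP0 z)
          (mul_nonneg hw (Finset.sum_nonneg fun j _ => add_nonneg hv (ha0 _ _ _)))]
        exact Finset.sum_congr rfl fun z _ => ENNReal.ofReal_mul (hP0 z)
    _ ≤ _ := Finset.sum_le_sum fun z _ => mul_le_mul_right (hrisk z) _

end LowerBound

/-! ### Convexity and power inequalities -/

section RealInequalities

/-- Bernoulli's inequality for (|t|/a)^q, followed by t ≤ |t|. -/
theorem tangent_le_abs_rpow {q a : ℝ} (hq : 1 ≤ q) (ha : 0 < a) (t : ℝ) :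
    a ^ q + q * a ^ (q - 1) * (t - a) ≤ |t| ^ q := by
  have h1 := one_add_mul_self_le_rpow_one_add (s := |t| / a - 1)
    (by linarith [div_nonneg (abs_nonneg t) ha.le]) hq
  rw [add_sub_cancel, Real.div_rpow (abs_nonneg t) ha.le,
    le_div_iff₀ (Real.rpow_pos_of_pos ha q)] at h1
  refine le_trans ?_ h1
  have h2 : a ^ q = a ^ (q - 1) * a := by
    rw [← Real.rpow_add_one ha.ne', sub_add_cancel]
  have h3 : (1 + q * (|t| / a - 1)) * a ^ q = a ^ q + q * a ^ (q - 1) * (|t| - a) := by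
    rw [h2]; field_simp
  rw [h3]
  have : 0 ≤ q * a ^ (q - 1) := by positivity
  have := mul_le_mul_of_nonneg_left (sub_le_sub_right (le_abs_self t) a) this
  linarith

theorem two_mul_rpow_le_abs_sub_add {q a : ℝ} (hq : 1 ≤ q) (ha : 0 < a) (t : ℝ) :
    2 * a ^ q ≤ |a - t| ^ q + |-a - t| ^ q := by
  have h1 := tangent_le_abs_rpow hq ha (a - t)
  have h2 := tangent_le_abs_rpow hq ha (a + t)
  rw [show -a - t = -(a + t) by ring, abs_neg]
  linarith

/-- `hcrit` is the first-order condition at h: adding the tangent bounds at the residuals B - h and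
h - u cancels the terms linear in t. -/
theorem two_point_loss_ge {q p p' B u h : ℝ} (hq : 1 ≤ q) (hp : 0 ≤ p) (hp' : 0 ≤ p')
    (hB : h < B) (hu : u < h) (hcrit : p * (B - h) ^ (q - 1) = p' * (h - u) ^ (q - 1)) (t : ℝ) :
    p * (B - h) ^ q + p' * (h - u) ^ q ≤ p * |B - t| ^ q + p' * |u - t| ^ q := by
  have h1 := mul_le_mul_of_nonneg_left (tangent_le_abs_rpow hq (sub_pos.2 hB) (B - t)) hp
  have h2 := mul_le_mul_of_nonneg_left (tangent_le_abs_rpow hq (sub_pos.2 hu) (t - u)) hp'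
  rw [abs_sub_comm u t]
  have h3 : p * ((B - h) ^ q + q * (B - h) ^ (q - 1) * (B - t - (B - h))) +
      p' * ((h - u) ^ q + q * (h - u) ^ (q - 1) * (t - u - (h - u))) =
      p * (B - h) ^ q + p' * (h - u) ^ q +
        q * (h - t) * (p * (B - h) ^ (q - 1) - p' * (h - u) ^ (q - 1)) := by ring
  rw [hcrit, sub_self, mul_zero, add_zero] at h3
  linarith

theorem one_sub_rpow_le {r u : ℝ} (hr : 0 < r) (hu0 : 0 ≤ u) (hu1 : u ≤ 1) :
    (1 - u) ^ r ≤ 1 - min 1 r * u := by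
  rcases le_total r 1 with h | h
  · rw [min_eq_right h]
    have := rpow_one_add_le_one_add_mul_self (s := -u) (by linarith) hr.le h
    rw [← sub_eq_add_neg] at this
    linarith
  · rw [min_eq_left h, one_mul]
    exact Real.rpow_le_self_of_le_one (by linarith) (by linarith) h

theorem rpow_one_add_sub_rpow_one_sub_le {ρ t : ℝ} (hρ : 0 ≤ ρ) (ht0 : 0 ≤ t) (ht : t ≤ 1 / 2) :
    (1 + t) ^ ρ - (1 - t) ^ ρ ≤ 4 * ρ * Real.exp (2 * ρ) * t := by
  have hs : (0 : ℝ) < 1 - t := by linarith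
  -- Uses (1 - t)(1 + 4t) = 1 + 3t - 4t², which is at least 1 + t because t ≤ 1/2.
  have h1 : 1 + t ≤ (1 - t) * Real.exp (4 * t) := by
    have := mul_le_mul_of_nonneg_left (Real.add_one_le_exp (4 * t)) hs.le
    nlinarith
  have h2 : (1 + t) ^ ρ ≤ (1 - t) ^ ρ * Real.exp (4 * t * ρ) := by
    rw [Real.exp_mul, ← Real.mul_rpow hs.le (Real.exp_pos _).le]
    exact Real.rpow_le_rpow (by linarith) h1 hρ
  have h3 : (1 - t) ^ ρ ≤ 1 := Real.rpow_le_one hs.le (by linarith) hρ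
  have h4 : 1 ≤ Real.exp (4 * t * ρ) := Real.one_le_exp (by positivity)
  have h5 : Real.exp (4 * t * ρ) - 1 ≤ 4 * t * ρ * Real.exp (4 * t * ρ) := by
    have := mul_le_mul_of_nonneg_right (Real.add_one_le_exp (-(4 * t * ρ)))
      (Real.exp_pos (4 * t * ρ)).le
    rw [← Real.exp_add, neg_add_cancel, Real.exp_zero] at this
    linarith
  have h6 : Real.exp (4 * t * ρ) ≤ Real.exp (2 * ρ) := Real.exp_le_exp.2 (by nlinarith)
  calc (1 + t) ^ ρ - (1 - t) ^ ρ ≤ (1 - t) ^ ρ * (Real.exp (4 * t * ρ) - 1) := by linarith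
    _ ≤ 1 * (Real.exp (4 * t * ρ) - 1) := mul_le_mul_of_nonneg_right h3 (by linarith)
    _ ≤ 4 * t * ρ * Real.exp (2 * ρ) := by
        rw [one_mul]
        exact h5.trans (mul_le_mul_of_nonneg_left h6 (by positivity))
    _ = _ := by ring

theorem half_le_one_sub_pow {n : ℕ} (hn : 1 ≤ n) {x : ℝ} (hx0 : 0 ≤ x) (hx : n * x ≤ 1 / 4) :
    1 / 2 ≤ (1 - x) ^ (2 * n) := by
  have hn' : (1 : ℝ) ≤ n := by exact_mod_cast hn
  have h := one_add_mul_le_pow (a := -x)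
    (by linarith [mul_le_mul_of_nonneg_right hn' hx0]) (2 * n)
  rw [← sub_eq_add_neg] at h
  push_cast at h
  linarith

end RealInequalities

/-! ### The heavy and the biased output pairs -/

section Cells

/-- The outputs `0`, `B` and `-B`. -/
def heavyOutput (B : ℝ) (s : Option Bool) : ℝ := s.elim 0 (signed B)

/-- The output `B` or `-B` according to `β` with probability `p`, and `0` otherwise. -/
def heavyLaw (p : ℝ) (β : Bool) (s : Option Bool) : ℝ :=
  s.elim (1 - p) fun β' => if β' = β then p else 0

/-- The output `B` or `-B`, the one according to `β` with probability `p`. -/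
def biasedLaw (p : ℝ) (β β' : Bool) : ℝ := if β' = β then p else 1 - p

theorem cellLoss_heavyLaw (q B p t : ℝ) (β : Bool) :
    cellLoss q (heavyOutput B) (heavyLaw p β) t =
      p * |signed B β - t| ^ q + (1 - p) * |0 - t| ^ q := by
  cases β <;>
  · simp only [cellLoss, heavyOutput, heavyLaw, signed, Fintype.sum_option, Fintype.sum_bool,
      Option.elim_none, Option.elim_some, Bool.true_eq_false, if_false, if_true,
      Bool.false_eq_true]
    ring

theorem cellLoss_biasedLaw (q B p t : ℝ) (β : Bool) :
    cellLoss q (signed B) (biasedLaw p β) t =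
      p * |signed B β - t| ^ q + (1 - p) * |-signed B β - t| ^ q := by
  cases β
  · simp only [cellLoss, biasedLaw, signed, Fintype.sum_bool, Bool.true_eq_false, if_false, if_true,
      Bool.false_eq_true, neg_neg]
    ring
  · simp [cellLoss, biasedLaw, signed]

theorem signed_two_point_loss_ge {q p p' B u h : ℝ} (hq : 1 ≤ q) (hp : 0 ≤ p) (hp' : 0 ≤ p')
    (hB : h < B) (hu : u < h) (hcrit : p * (B - h) ^ (q - 1) = p' * (h - u) ^ (q - 1)) (β : Bool)
    (t : ℝ) : p * (B - h) ^ q + p' * (h - u) ^ q ≤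
      p * |signed B β - t| ^ q + p' * |signed u β - t| ^ q := by
  cases β
  · have := two_point_loss_ge hq hp hp' hB hu hcrit (-t)
    simp only [signed, Bool.false_eq_true, if_false]
    rwa [show -B - t = -(B - -t) by ring, show -u - t = -(u - -t) by ring, abs_neg, abs_neg]
  · exact two_point_loss_ge hq hp hp' hB hu hcrit t

theorem signed_two_point_loss_eq {q p p' B u h : ℝ} (hB : h < B) (hu : u < h) (β : Bool) :
    p * |signed B β - signed h β| ^ q + p' * |signed u β - signed h β| ^ q =
      p * (B - h) ^ q + p' * (h - u) ^ q := by
  cases β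
  · simp only [signed, Bool.false_eq_true, if_false]
    rw [show -B - -h = -(B - h) by ring, show -u - -h = h - u by ring, abs_neg,
      abs_of_pos (sub_pos.2 hB), abs_of_pos (sub_pos.2 hu)]
  · simp only [signed, if_true]
    rw [abs_sub_comm u h, abs_of_pos (sub_pos.2 hB), abs_of_pos (sub_pos.2 hu)]

/-- A pair of finitely supported output laws `ν true`, `ν false` on the points `y`, whose optimal
predictions are `h` and `-h` with optimal loss `v`, such that every prediction has an excess loss
of at least `γ` on average over the two laws. -/
structure IsOutputPair {S : Type*} [Fintype S] (q h : ℝ) (y : S → ℝ) (ν : Bool → S → ℝ)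
    (v γ : ℝ) : Prop where
  nonneg : ∀ β s, 0 ≤ ν β s
  sum_eq_one : ∀ β, ∑ s, ν β s = 1
  value_nonneg : 0 ≤ v
  gap_nonneg : 0 ≤ γ
  value_le : ∀ β t, v ≤ cellLoss q y (ν β) t
  loss_le : ∀ β, cellLoss q y (ν β) (signed h β) ≤ v
  gap_le : ∀ t, 2 * (v + γ) ≤ cellLoss q y (ν true) t + cellLoss q y (ν false) t

/-- The weight p solves the first-order condition for optimality of ±h, so it is of order
(h/B)^(q-1). Discarding the loss at output 0, the two losses sum to at least 2 p B^q, and γ = p B^q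
- v keeps the order h^q however large B is. -/
theorem exists_heavyLaw {q h B : ℝ} (hq : 1 < q) (hh : 0 < h) (hB : 2 * h ≤ B) :
    ∃ p v γ : ℝ, IsOutputPair q h (heavyOutput B) (heavyLaw p) v γ ∧ 0 ≤ p ∧
      p ≤ (2 * h / B) ^ (q - 1) ∧ min 1 (q - 1) * h ^ q / 2 ≤ γ := by
  obtain ⟨r, rfl⟩ : ∃ r, q = r + 1 := ⟨q - 1, by ring⟩
  have hr : 0 < r := by linarith
  have hB0 : 0 < B := by linarith
  have hhB : h < B := by linarith
  have hBh : 0 < B - h := sub_pos.2 hhB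
  set a := h ^ r with ha
  set c := (B - h) ^ r with hc
  have ha0 : 0 < a := Real.rpow_pos_of_pos hh r
  have hc0 : 0 < c := Real.rpow_pos_of_pos hBh r
  have haB : a ≤ B ^ r := Real.rpow_le_rpow hh.le hhB.le hr.le
  have hcB : c ≤ B ^ r := Real.rpow_le_rpow hBh.le (by linarith) hr.le
  have hBr : 0 < B ^ r := Real.rpow_pos_of_pos hB0 r
  set p := a / (a + c) with hp
  have hp0 : 0 ≤ p := by positivity
  have hp1 : 1 - p = c / (a + c) := by rw [hp]; field_simp; ring
  have hp10 : 0 ≤ 1 - p := by rw [hp1]; positivity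
  have hcrit : p * (B - h) ^ (r + 1 - 1) = (1 - p) * (h - 0) ^ (r + 1 - 1) := by
    rw [add_sub_cancel_right, sub_zero, hp1, hp, ← ha, ← hc]; field_simp
  have hv : p * (B - h) ^ (r + 1) + (1 - p) * (h - 0) ^ (r + 1) = p * c * B := by
    rw [add_sub_cancel_right, sub_zero, ← hc, ← ha] at hcrit
    rw [sub_zero, Real.rpow_add_one hBh.ne', Real.rpow_add_one hh.ne', ← hc, ← ha, ← mul_assoc,
      ← mul_assoc, ← hcrit]
    ring
  have hsu : ∀ β, signed 0 β = 0 := fun β => by cases β <;> simp [signed]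
  refine ⟨p, p * c * B, p * B * (B ^ r - c), ⟨?_, ?_, by positivity, ?_, ?_, ?_, ?_⟩, hp0, ?_, ?_⟩
  · rintro β (_ | β')
    · exact hp10
    · simp only [heavyLaw, Option.elim_some]; split_ifs <;> linarith
  · intro β
    simp [heavyLaw, Fintype.sum_option]
  · exact mul_nonneg (by positivity) (sub_nonneg.2 hcB)
  · intro β t
    rw [cellLoss_heavyLaw, ← hv]
    have := signed_two_point_loss_ge hq.le hp0 hp10 hhB hh hcrit β t
    rwa [hsu] at this
  · intro β
    have := signed_two_point_loss_eq (q := r + 1) (p := p) (p' := 1 - p) hhB hh β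
    rw [hsu] at this
    rw [cellLoss_heavyLaw, this, hv]
  · intro t
    have h1 := mul_le_mul_of_nonneg_left (two_mul_rpow_le_abs_sub_add hq.le hB0 t) hp0
    have h2 : 0 ≤ (1 - p) * |0 - t| ^ (r + 1) := mul_nonneg hp10 (by positivity)
    rw [cellLoss_heavyLaw, cellLoss_heavyLaw]
    simp only [signed, Bool.false_eq_true, if_false, if_true]
    rw [Real.rpow_add_one hB0.ne'] at h1
    linarith
  · rw [add_sub_cancel_right]
    calc p ≤ a / c := div_le_div_of_nonneg_left ha0.le hc0 (by linarith)
      _ = (h / (B - h)) ^ r := (Real.div_rpow hh.le hBh.le r).symm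
      _ ≤ (2 * h / B) ^ r := by
        refine Real.rpow_le_rpow (by positivity) ?_ hr.le
        rw [div_le_div_iff₀ hBh hB0]
        nlinarith
  · rw [add_sub_cancel_right]
    have ht1 : h / B ≤ 1 := (div_le_one hB0).2 hhB.le
    have h1 := one_sub_rpow_le hr (div_nonneg hh.le hB0.le) ht1
    have h2 : c = B ^ r * (1 - h / B) ^ r := by
      rw [← Real.mul_rpow hB0.le (by linarith), hc]; congr 1; field_simp
    have h3 : B ^ r * (min 1 r * (h / B)) ≤ B ^ r - c := by
      rw [h2]
      have := mul_le_mul_of_nonneg_left h1 hBr.le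
      linarith
    have h4 : a / 2 ≤ p * B ^ r := by
      rw [hp, div_mul_eq_mul_div, div_le_div_iff₀ two_pos (by positivity)]
      have : a + c ≤ B ^ r * 2 := by linarith
      rw [mul_assoc]
      exact mul_le_mul_of_nonneg_left this ha0.le
    have hm : 0 ≤ min 1 r := le_min zero_le_one hr.le
    calc min 1 r * h ^ (r + 1) / 2 = a / 2 * (min 1 r * h) := by
          rw [Real.rpow_add_one hh.ne', ← ha]; ring
      _ ≤ p * B ^ r * (min 1 r * h) := mul_le_mul_of_nonneg_right h4 (by positivity)
      _ = p * B * (B ^ r * (min 1 r * (h / B))) := by field_simp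
      _ ≤ _ := mul_le_mul_of_nonneg_left h3 (by positivity)

/-- Here the two losses sum to at least 2 B^q, attained at t = 0, so γ = B^q - v. Both γ/B^q and the
affinity defect are of second order in h/B. -/
theorem exists_biasedLaw {q h B : ℝ} (hq : 1 < q) (hh : 0 < h) (hB : 2 * h ≤ B) :
    ∃ p v γ : ℝ, IsOutputPair q h (signed B) (biasedLaw p) v γ ∧
      1 - ∑ s, √(biasedLaw p true s * biasedLaw p false s) ≤
        (2 * (q - 1) * Real.exp (q - 1)) ^ 2 * (h / B) ^ 2 ∧
      0 ≤ 1 - ∑ s, √(biasedLaw p true s * biasedLaw p false s) ∧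
      min 1 ((q - 1) / 2) * B ^ q * (h / B) ^ 2 ≤ γ := by
  obtain ⟨r, rfl⟩ : ∃ r, q = r + 1 := ⟨q - 1, by ring⟩
  have hr : 0 < r := by linarith
  have hB0 : 0 < B := by linarith
  have hhB : h < B := by linarith
  have hBh : 0 < B - h := sub_pos.2 hhB
  have hBh' : 0 < B + h := by linarith
  set t₀ := h / B with ht₀
  have ht0 : 0 ≤ t₀ := by positivity
  have ht1 : t₀ ≤ 1 / 2 := by rw [ht₀, div_le_div_iff₀ hB0 two_pos]; linarith
  have hBr : 0 < B ^ r := Real.rpow_pos_of_pos hB0 r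
  -- Half exponents make √(p(1 - p)) rational in a and c, and the affinity defect becomes (a -
  -- c)²/(a² + c²).
  set a := (B + h) ^ (r / 2) with ha
  set c := (B - h) ^ (r / 2) with hc
  have ha0 : 0 < a := Real.rpow_pos_of_pos hBh' _
  have hc0 : 0 < c := Real.rpow_pos_of_pos hBh _
  have ha2 : (B + h) ^ r = a ^ 2 := by
    rw [ha, ← Real.rpow_mul_natCast hBh'.le]; congr 1; push_cast; ring
  have hc2 : (B - h) ^ r = c ^ 2 := by
    rw [hc, ← Real.rpow_mul_natCast hBh.le]; congr 1; push_cast; ring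
  have hBr2 : B ^ r = (B ^ (r / 2)) ^ 2 := by
    rw [← Real.rpow_mul_natCast hB0.le]; congr 1; push_cast; ring
  have haB : a = B ^ (r / 2) * (1 + t₀) ^ (r / 2) := by
    rw [← Real.mul_rpow hB0.le (by linarith), ha]; congr 1; rw [ht₀]; field_simp
  have hcB : c = B ^ (r / 2) * (1 - t₀) ^ (r / 2) := by
    rw [← Real.mul_rpow hB0.le (by linarith), hc]; congr 1; rw [ht₀]; field_simp
  have hca : c ≤ a := Real.rpow_le_rpow hBh.le (by linarith) (by positivity)
  have hac : a * c ≤ B ^ r * (1 - min 1 (r / 2) * t₀ ^ 2) := by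
    have h1 := one_sub_rpow_le (half_pos hr) (sq_nonneg t₀) (by nlinarith)
    have h2 : a * c = B ^ r * (1 - t₀ ^ 2) ^ (r / 2) := by
      rw [show 1 - t₀ ^ 2 = (1 + t₀) * (1 - t₀) by ring,
        Real.mul_rpow (by linarith) (by linarith), haB, hcB, hBr2]
      ring
    rw [h2]
    exact mul_le_mul_of_nonneg_left h1 hBr.le
  set p := a ^ 2 / (a ^ 2 + c ^ 2) with hp
  have hp0 : 0 ≤ p := by positivity
  have hp1 : 1 - p = c ^ 2 / (a ^ 2 + c ^ 2) := by rw [hp]; field_simp; ring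
  have hp10 : 0 ≤ 1 - p := by rw [hp1]; positivity
  have hcrit : p * (B - h) ^ (r + 1 - 1) = (1 - p) * (h - -B) ^ (r + 1 - 1) := by
    rw [add_sub_cancel_right, sub_neg_eq_add, add_comm h B, ha2, hc2, hp1, hp]; field_simp
  have hv : p * (B - h) ^ (r + 1) + (1 - p) * (h - -B) ^ (r + 1) =
      B * (2 * (a * c) ^ 2 / (a ^ 2 + c ^ 2)) := by
    rw [sub_neg_eq_add, add_comm h B, Real.rpow_add_one hBh.ne', Real.rpow_add_one hBh'.ne', ha2,
      hc2, hp1, hp]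
    field_simp
    ring
  have hle : 2 * (a * c) ^ 2 / (a ^ 2 + c ^ 2) ≤ a * c := by
    rw [div_le_iff₀ (by positivity)]
    nlinarith [mul_nonneg (mul_pos ha0 hc0).le (sq_nonneg (a - c))]
  have hgap : min 1 (r / 2) * B ^ (r + 1) * t₀ ^ 2 ≤
      B * (B ^ r - 2 * (a * c) ^ 2 / (a ^ 2 + c ^ 2)) := by
    rw [Real.rpow_add_one hB0.ne']
    have := mul_le_mul_of_nonneg_left (hle.trans hac) hB0.le
    linarith
  have haff : 1 - ∑ s, √(biasedLaw p true s * biasedLaw p false s) =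
      (a - c) ^ 2 / (a ^ 2 + c ^ 2) := by
    have h1 : √(p * (1 - p)) = a * c / (a ^ 2 + c ^ 2) := by
      rw [hp1, hp, div_mul_div_comm, ← mul_pow, ← sq, ← div_pow, Real.sqrt_sq (by positivity)]
    simp only [biasedLaw, Fintype.sum_bool, if_true, Bool.false_eq_true, Bool.true_eq_false,
      if_false]
    rw [mul_comm (1 - p), h1]
    field_simp
    ring
  have hsu : ∀ β, signed (-B) β = -signed B β := fun β => by cases β <;> simp [signed]
  refine ⟨p, B * (2 * (a * c) ^ 2 / (a ^ 2 + c ^ 2)),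
    B * (B ^ r - 2 * (a * c) ^ 2 / (a ^ 2 + c ^ 2)),
    ⟨?_, ?_, by positivity, ?_, ?_, ?_, ?_⟩, ?_, ?_, ?_⟩
  · intro β β'
    simp only [biasedLaw]; split_ifs <;> linarith
  · intro β
    cases β <;> simp [biasedLaw]
  · exact le_trans (by positivity) hgap
  · intro β t
    rw [cellLoss_biasedLaw, ← hv, ← hsu]
    exact signed_two_point_loss_ge hq.le hp0 hp10 hhB (by linarith) hcrit β t
  · intro β
    rw [cellLoss_biasedLaw, ← hv, ← hsu]
    exact (signed_two_point_loss_eq hhB (by linarith) β).le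
  · intro t
    have h1 := two_mul_rpow_le_abs_sub_add hq.le hB0 t
    rw [cellLoss_biasedLaw, cellLoss_biasedLaw]
    simp only [signed, Bool.false_eq_true, if_false, if_true, neg_neg]
    rw [Real.rpow_add_one hB0.ne'] at h1
    linarith
  · rw [haff, add_sub_cancel_right, div_le_iff₀ (by positivity)]
    have h1 := rpow_one_add_sub_rpow_one_sub_le (half_pos hr).le ht0 ht1
    have h2 : a - c ≤ B ^ (r / 2) * (2 * r * Real.exp r * t₀) := by
      rw [haB, hcB, ← mul_sub]
      refine mul_le_mul_of_nonneg_left (h1.trans (le_of_eq ?_)) (by positivity)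
      rw [show 2 * (r / 2) = r by ring]; ring
    have h3 : B ^ r ≤ a ^ 2 + c ^ 2 := by
      rw [← ha2]
      have := Real.rpow_le_rpow hB0.le (by linarith : B ≤ B + h) hr.le
      nlinarith [sq_nonneg c]
    calc (a - c) ^ 2 ≤ (B ^ (r / 2) * (2 * r * Real.exp r * t₀)) ^ 2 :=
          pow_le_pow_left₀ (sub_nonneg.2 hca) h2 2
      _ = (2 * r * Real.exp r) ^ 2 * t₀ ^ 2 * B ^ r := by rw [hBr2]; ring
      _ ≤ _ := mul_le_mul_of_nonneg_left h3 (by positivity)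
  · rw [haff]; positivity
  · rw [add_sub_cancel_right]; exact hgap

end Cells

/-! ### Tuning cell mass and output size -/

section Design

theorem abs_signed {h : ℝ} (hh : 0 ≤ h) (β : Bool) : |signed h β| = h := by
  cases β <;> simp [signed, abs_of_nonneg hh]

/-- The parameters of a family of hypercube laws on `k` cells for which, with samples of size `n`,
every estimator has an excess risk of at least `ε` and the outputs have an `s`-th moment of at
most `A`. -/
structure HypercubeDesign (q s h A : ℝ) (k n : ℕ) (ε : ℝ) (S : Type) [Fintype S] where
  /-- the possible outputs -/
  y : S → ℝ
  /-- the mass of a cell -/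
  w : ℝ
  /-- the two output laws -/
  ν : Bool → S → ℝ
  /-- the optimal loss -/
  v : ℝ
  /-- the average excess loss of a prediction -/
  γ : ℝ
  /-- a bound for the moments of the output laws -/
  M : ℝ
  isOutputPair : IsOutputPair q h y ν v γ
  w_nonneg : 0 ≤ w
  mul_w_le : k * w ≤ 1
  affinity : 1 / 2 ≤ (1 - w * (1 - ∑ s, √(ν true s * ν false s))) ^ (2 * n)
  moment_le : ∀ β, ∑ t, ν β t * |y t| ^ s ≤ M
  mul_moment_le : k * w * M ≤ A
  le_excess : ε ≤ k * w * (γ / 4)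

theorem HypercubeDesign.exists_law {X : Type u} [MeasurableSpace X] {q s h A ε : ℝ} {k n : ℕ}
    {S : Type} [Fintype S] (D : HypercubeDesign q s h A k n ε S) (hq : 0 < q) (hs : 0 < s)
    (pt : Option (Fin k) → X) (e : Estimator.{u, v} X n) :
    ∃ P : Measure (X × ℝ), IsProbabilityMeasure P ∧
      ∫⁻ z, ENNReal.ofReal (|z.2| ^ s) ∂P ≤ ENNReal.ofReal A ∧
      (∀ g : X → ℝ, Measurable g → risk q P g < ∞) ∧
      ∃ (σ : Fin k → Bool) (m : ℝ≥0∞),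
        (∀ g : X → ℝ, Measurable g → g (pt none) = 0 →
          (∀ j, g (pt (some j)) = signed h (σ j)) → risk q P g ≤ m) ∧
        m + ENNReal.ofReal ε ≤ e.expectedRisk q P := by
  have hO := D.isOutputPair
  have hw := D.w_nonneg
  have hv := hO.value_nonneg
  have hγ := hO.gap_nonneg
  obtain ⟨σ, hσ⟩ := exists_cubeLaw_le_expectedRisk pt D.y hw D.mul_w_le hO.nonneg hO.sum_eq_one
    hv hγ hO.value_le hO.gap_le D.affinity e
  refine ⟨cubeLaw pt D.y D.w D.ν σ,
    isProbabilityMeasure_cubeLaw pt D.y hw D.mul_w_le hO.nonneg hO.sum_eq_one σ, ?_, ?_, σ,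
    ENNReal.ofReal (k * D.w * D.v), ?_, ?_⟩
  · rw [lintegral_cubeLaw pt D.y hw D.mul_w_le hO.nonneg σ (f := fun z => |z.2| ^ s)
      (by fun_prop) fun _ => by positivity]
    refine ENNReal.ofReal_le_ofReal (le_trans ?_ D.mul_moment_le)
    have h1 : ∑ j, ∑ t, D.ν (σ j) t * |D.y t| ^ s ≤ k * D.M :=
      (Finset.sum_le_sum fun j _ => D.moment_le (σ j)).trans (by simp)
    have := mul_le_mul_of_nonneg_left h1 hw
    simp only [abs_zero, Real.zero_rpow hs.ne', mul_zero, zero_add]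
    linarith
  · intro g hg
    rw [risk_cubeLaw pt D.y hw D.mul_w_le hO.nonneg σ q hg]
    exact ENNReal.ofReal_lt_top
  · intro g hg h0 hj
    rw [risk_cubeLaw pt D.y hw D.mul_w_le hO.nonneg σ q hg]
    refine ENNReal.ofReal_le_ofReal ?_
    have hle : ∀ j, cellLoss q D.y (D.ν (σ j)) (g (pt (some j))) ≤ D.v := fun j => by
      rw [hj]; exact hO.loss_le (σ j)
    have h1 : ∑ j, cellLoss q D.y (D.ν (σ j)) (g (pt (some j))) ≤ k * D.v :=
      (Finset.sum_le_sum fun j _ => hle j).trans (by simp)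
    have := mul_le_mul_of_nonneg_left h1 hw
    rw [h0, abs_zero, Real.zero_rpow hq.ne', mul_zero, zero_add]
    linarith
  · refine le_trans ?_ hσ
    have : 0 ≤ k * D.w * D.v := by positivity
    rw [ENNReal.ofReal_add this (by positivity)]
    gcongr
    exact D.le_excess

theorem exists_heavy_design {q s b A : ℝ} (hq : 1 < q) (hs : q ≤ s) (hb : 0 < b) (hA : 0 < A) :
    ∃ C : ℝ, 0 < C ∧ ∀ k n : ℕ, 1 ≤ k → k ≤ n → Nonempty (HypercubeDesign q s b A k n
      (C * ((k : ℝ) / n) ^ (1 - (q - 1) / s)) (Option Bool)) := by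
  have hs0 : 0 < s := by linarith
  have hr : 0 < q - 1 := by linarith
  -- The first bound keeps n w p ≤ 1/4; the second is the moment constraint.
  set c := min (1 / 4) (A / (2 * b) ^ s) with hc
  have hbs : 0 < (2 * b) ^ s := by positivity
  have hc0 : 0 < c := lt_min (by norm_num) (by positivity)
  have hc4 : c ≤ 1 / 4 := min_le_left _ _
  have hcA : c * (2 * b) ^ s ≤ A := (le_div_iff₀ hbs).1 (min_le_right _ _)
  have hm : 0 < min 1 (q - 1) := lt_min one_pos hr
  refine ⟨c * (min 1 (q - 1) * b ^ q / 2 / 4), by positivity, fun k n hk hkn => ?_⟩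
  have hk0 : (0 : ℝ) < k := by exact_mod_cast hk
  have hn0 : (0 : ℝ) < n := by exact_mod_cast hk.trans hkn
  set x : ℝ := k / n with hx
  have hx0 : 0 < x := by positivity
  have hx1 : x ≤ 1 := (div_le_one hn0).2 (by exact_mod_cast hkn)
  -- With B = 2b/ξ and p ≤ R = ξ^(q-1), the mass w = c/(nR) is the largest order that keeps
  -- neighbours indistinguishable. Then kw = c x/R, and the s-th moment is at most c (2b)^s.
  set ξ := x ^ (1 / s) with hξ
  have hξ0 : 0 < ξ := Real.rpow_pos_of_pos hx0 _
  have hξ1 : ξ ≤ 1 := Real.rpow_le_one hx0.le hx1 (by positivity)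
  have hξs : ξ ^ s = x := by
    rw [hξ, ← Real.rpow_mul hx0.le, one_div_mul_cancel hs0.ne', Real.rpow_one]
  set R := ξ ^ (q - 1) with hR
  have hR0 : 0 < R := Real.rpow_pos_of_pos hξ0 _
  have hRx : x ^ (1 - (q - 1) / s) = x / R := by
    rw [Real.rpow_sub hx0, Real.rpow_one, hR, hξ, ← Real.rpow_mul hx0.le, one_div_mul_eq_div]
  have hxR : x ≤ R := by
    rw [← hξs]
    exact Real.rpow_le_rpow_of_exponent_ge hξ0 hξ1 (by linarith)
  obtain ⟨p, v, γ, hO, hp0, hp, hγ⟩ := exists_heavyLaw (B := 2 * b / ξ) hq hb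
    (by rw [le_div_iff₀ hξ0]; nlinarith)
  have hpR : p ≤ R := by
    rwa [show 2 * b / (2 * b / ξ) = ξ by field_simp] at hp
  have hkw : k * (c / (n * R)) = c * (x / R) := by rw [hx]; field_simp
  refine ⟨{
    y := heavyOutput (2 * b / ξ)
    w := c / (n * R)
    ν := heavyLaw p
    v := v
    γ := γ
    M := R * ((2 * b) ^ s / x)
    isOutputPair := hO
    w_nonneg := by positivity
    mul_w_le := ?_
    affinity := ?_
    moment_le := ?_
    mul_moment_le := ?_
    le_excess := ?_ }⟩
  · rw [hkw]
    have : x / R ≤ 1 := (div_le_one hR0).2 hxR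
    nlinarith
  · have hp1 : 0 ≤ 1 - p := hO.nonneg true none
    have haff : 1 - ∑ t, √(heavyLaw p true t * heavyLaw p false t) = p := by
      simp [heavyLaw, Fintype.sum_option, Real.sqrt_mul_self hp1]
    rw [haff]
    refine half_le_one_sub_pow (hk.trans hkn) (by positivity) ?_
    calc n * (c / (n * R) * p) = c * (p / R) := by field_simp
      _ ≤ c * 1 := mul_le_mul_of_nonneg_left ((div_le_one hR0).2 hpR) hc0.le
      _ ≤ 1 / 4 := by rwa [mul_one]
  · intro β
    have hy : |signed (2 * b / ξ) β| ^ s = (2 * b) ^ s / x := by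
      rw [abs_signed (by positivity), Real.div_rpow (by positivity) hξ0.le, hξs]
    have : ∑ t, heavyLaw p β t * |heavyOutput (2 * b / ξ) t| ^ s =
        p * |signed (2 * b / ξ) β| ^ s := by
      cases β <;> simp [heavyLaw, heavyOutput, Fintype.sum_option, Real.zero_rpow hs0.ne']
    rw [this, hy]
    exact mul_le_mul_of_nonneg_right hpR (by positivity)
  · rw [hkw]
    refine le_trans (le_of_eq ?_) hcA
    field_simp
  · rw [hkw, hRx]
    have : c * (x / R) * (min 1 (q - 1) * b ^ q / 2 / 4) ≤ c * (x / R) * (γ / 4) := by gcongr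
    linarith

theorem exists_biased_design {q s b A : ℝ} (hq : 1 < q) (hs : q ≤ s) (hb : 0 < b) (hA : 0 < A) :
    ∃ C : ℝ, 0 < C ∧ ∀ k n : ℕ, 1 ≤ k → k ≤ n → Nonempty (HypercubeDesign q s b A k n
      (C * ((k : ℝ) / n) ^ (1 - q / (s + 2))) Bool) := by
  have hs0 : 0 < s := by linarith
  have hr : 0 < q - 1 := by linarith
  set K := (2 * (q - 1) * Real.exp (q - 1)) ^ 2 with hK
  have hK0 : 0 < K := by positivity
  -- The three bounds serve the total mass, the affinity and the moment, in this order.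
  set c := min (min 1 (1 / K)) (A / (2 * b) ^ s) with hc
  have hbs : 0 < (2 * b) ^ s := by positivity
  have hc0 : 0 < c := lt_min (lt_min one_pos (by positivity)) (by positivity)
  have hc1 : c ≤ 1 := (min_le_left _ _).trans (min_le_left _ _)
  have hcK : c * K ≤ 1 := (le_div_iff₀ hK0).1 ((min_le_left _ _).trans (min_le_right _ _))
  have hcA : c * (2 * b) ^ s ≤ A := (le_div_iff₀ hbs).1 (min_le_right _ _)
  have hm : 0 < min 1 ((q - 1) / 2) := lt_min one_pos (by positivity)
  refine ⟨c * (min 1 ((q - 1) / 2) * (2 * b) ^ q / 16), by positivity, fun k n hk hkn => ?_⟩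
  have hk0 : (0 : ℝ) < k := by exact_mod_cast hk
  have hn0 : (0 : ℝ) < n := by exact_mod_cast hk.trans hkn
  set x : ℝ := k / n with hx
  have hx0 : 0 < x := by positivity
  have hx1 : x ≤ 1 := (div_le_one hn0).2 (by exact_mod_cast hkn)
  -- With B = 2b/ξ the affinity defect is of order ξ², which allows w = c/(nξ²) and kw = c x/ξ². The
  -- moment is of order kw ξ^(-s), and it stays bounded when ξ^(s+2) = x.
  set ξ := x ^ (1 / (s + 2)) with hξ
  have hξ0 : 0 < ξ := Real.rpow_pos_of_pos hx0 _
  have hξ1 : ξ ≤ 1 := Real.rpow_le_one hx0.le hx1 (by positivity)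
  have hξs : ξ ^ s * ξ ^ 2 = x := by
    rw [← Real.rpow_natCast ξ 2, ← Real.rpow_add hξ0, hξ, ← Real.rpow_mul hx0.le, Nat.cast_ofNat,
      one_div_mul_cancel (by positivity), Real.rpow_one]
  have hξs0 : 0 < ξ ^ s := Real.rpow_pos_of_pos hξ0 _
  have hξs1 : ξ ^ s ≤ 1 := Real.rpow_le_one hξ0.le hξ1 hs0.le
  have hξq0 : 0 < ξ ^ q := Real.rpow_pos_of_pos hξ0 _
  have hqx : x ^ (1 - q / (s + 2)) = x / ξ ^ q := by
    rw [Real.rpow_sub hx0, Real.rpow_one, hξ, ← Real.rpow_mul hx0.le, one_div_mul_eq_div]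
  obtain ⟨p, v, γ, hO, haff, haff0, hγ⟩ := exists_biasedLaw (B := 2 * b / ξ) hq hb
    (by rw [le_div_iff₀ hξ0]; nlinarith)
  rw [show b / (2 * b / ξ) = ξ / 2 by field_simp] at haff hγ
  have hkw : k * (c / (n * ξ ^ 2)) = c * ξ ^ s := by
    have : k * (c / (n * ξ ^ 2)) = c * x / ξ ^ 2 := by rw [hx]; field_simp
    rw [this, ← hξs]; field_simp
  refine ⟨{
    y := signed (2 * b / ξ)
    w := c / (n * ξ ^ 2)
    ν := biasedLaw p
    v := v
    γ := γ
    M := (2 * b) ^ s / ξ ^ s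
    isOutputPair := hO
    w_nonneg := by positivity
    mul_w_le := ?_
    affinity := ?_
    moment_le := ?_
    mul_moment_le := ?_
    le_excess := ?_ }⟩
  · rw [hkw]
    exact mul_le_one₀ hc1 hξs0.le hξs1
  · refine half_le_one_sub_pow (hk.trans hkn) (by positivity) ?_
    calc _ ≤ n * (c / (n * ξ ^ 2) * (K * (ξ / 2) ^ 2)) := by gcongr
      _ = c * K / 4 := by field_simp; norm_num
      _ ≤ 1 / 4 := by linarith
  · intro β
    have hy : ∀ β', |signed (2 * b / ξ) β'| ^ s = (2 * b) ^ s / ξ ^ s := by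
      intro β'
      rw [abs_signed (by positivity), Real.div_rpow (by positivity) hξ0.le]
    simp only [hy]
    rw [← Finset.sum_mul, hO.sum_eq_one, one_mul]
  · rw [hkw]
    refine le_trans (le_of_eq ?_) hcA
    field_simp
  · rw [hkw, hqx]
    calc c * (min 1 ((q - 1) / 2) * (2 * b) ^ q / 16) * (x / ξ ^ q)
        = c * ξ ^ s * (min 1 ((q - 1) / 2) * (2 * b / ξ) ^ q * (ξ / 2) ^ 2 / 4) := by
          rw [Real.div_rpow (by positivity) hξ0.le, ← hξs]; field_simp; norm_num
      _ ≤ _ := by gcongr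

end Design

/-! ### Comparing rates and choosing the design -/

theorem min_log_div_rpow_le {d n : ℕ} (hd : 2 ≤ d) {e : ℝ} (he0 : 0 ≤ e) (he1 : e ≤ 1) :
    (min (Real.log d / n) 1) ^ e ≤ 2 * (((min (Nat.log 2 d) n : ℕ) : ℝ) / n) ^ e := by
  rcases Nat.eq_zero_or_pos n with rfl | hn
  · simp only [Nat.cast_zero, div_zero, min_eq_left zero_le_one]
    have : (0 : ℝ) ≤ 0 ^ e := Real.zero_rpow_nonneg e
    linarith
  have hn0 : (0 : ℝ) < n := by exact_mod_cast hn
  have hL : 1 ≤ Nat.log 2 d := Nat.log_pos one_lt_two hd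
  have hL' : (1 : ℝ) ≤ Nat.log 2 d := by exact_mod_cast hL
  have hd0 : (0 : ℝ) < d := by exact_mod_cast (by omega : 0 < d)
  -- Rounding the logarithm down costs a factor at most 2 because `Nat.log 2 d` ≥ 1; this is why the
  -- final constant is C/2.
  have hlog : Real.log d ≤ 2 * Nat.log 2 d := by
    have h1 : (d : ℝ) ≤ 2 ^ (Nat.log 2 d + 1) := by
      exact_mod_cast (Nat.lt_pow_succ_log_self one_lt_two d).le
    have h2 := Real.log_le_log hd0 h1
    rw [Real.log_pow] at h2
    push_cast at h2
    have h3 : Real.log 2 ≤ 1 := by linarith [Real.log_two_lt_d9]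
    nlinarith [Real.log_pos one_lt_two]
  have hx0 : (0 : ℝ) ≤ ((min (Nat.log 2 d) n : ℕ) : ℝ) / n := by positivity
  have hle : min (Real.log d / n) 1 ≤ 2 * (((min (Nat.log 2 d) n : ℕ) : ℝ) / n) := by
    rcases le_total (Nat.log 2 d) n with h | h
    · rw [min_eq_left h]
      refine (min_le_left _ _).trans ?_
      rw [mul_div_assoc']
      gcongr
    · rw [min_eq_right h, div_self hn0.ne']
      exact (min_le_right _ _).trans (by norm_num)
  have h0 : 0 ≤ min (Real.log d / n) 1 :=
    le_min (div_nonneg (Real.log_natCast_nonneg d) hn0.le) zero_le_one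
  calc (min (Real.log d / n) 1) ^ e
      ≤ (2 * (((min (Nat.log 2 d) n : ℕ) : ℝ) / n)) ^ e := Real.rpow_le_rpow h0 hle he0
    _ = 2 ^ e * (((min (Nat.log 2 d) n : ℕ) : ℝ) / n) ^ e := Real.mul_rpow two_pos.le hx0
    _ ≤ _ := by
      gcongr
      exact (Real.rpow_le_rpow_of_exponent_le one_le_two he1).trans (by rw [Real.rpow_one])

theorem exists_design {q s b A : ℝ} (hq : 1 < q) (hs : q ≤ s) (hb : 0 < b) (hA : 0 < A) :
    ∃ C : ℝ, 0 < C ∧ ∀ k n : ℕ, 1 ≤ k → k ≤ n → ∃ (S : Type) (_ : Fintype S) (ε : ℝ),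
      Nonempty (HypercubeDesign q s b A k n ε S) ∧
      C * ((k : ℝ) / n) ^ (1 - (q - 1) / s) ≤ ε ∧ C * ((k : ℝ) / n) ^ (1 - q / (s + 2)) ≤ ε := by
  obtain ⟨C₁, hC₁, h₁⟩ := exists_heavy_design hq hs hb hA
  obtain ⟨C₂, hC₂, h₂⟩ := exists_biased_design hq hs hb hA
  refine ⟨min C₁ C₂, lt_min hC₁ hC₂, fun k n hk hkn => ?_⟩
  have hk0 : (0 : ℝ) < k := by exact_mod_cast hk
  have hn0 : (0 : ℝ) < n := by exact_mod_cast hk.trans hkn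
  have hx0 : (0 : ℝ) < k / n := by positivity
  have hx1 : (k : ℝ) / n ≤ 1 := (div_le_one hn0).2 (by exact_mod_cast hkn)
  -- As k/n ≤ 1, the design with the smaller exponent dominates both rates.
  rcases le_total (1 - (q - 1) / s) (1 - q / (s + 2)) with h | h
  · have := Real.rpow_le_rpow_of_exponent_ge hx0 hx1 h
    refine ⟨_, _, _, h₁ k n hk hkn, ?_, ?_⟩ <;> gcongr <;> exact min_le_left _ _
  · have := Real.rpow_le_rpow_of_exponent_ge hx0 hx1 h
    refine ⟨_, _, _, h₂ k n hk hkn, ?_, ?_⟩ <;> gcongr <;> exact min_le_right _ _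

end LqRegression

theorem theorem8p6 (q s b A : ℝ) (hq : 1 < q) (hs : q ≤ s) (hb : 0 < b) (hA : 0 < A) :
    ∃ C : ℝ, 0 < C ∧
      ∀ (d n : ℕ), 1 ≤ d → 1 ≤ n →
      ∀ (X : Type u) [MeasurableSpace X] [MeasurableSpace.SeparatesPoints X],
      ((Nat.log 2 (2 * d) : ℕ) : ℕ∞) ≤ ENat.card X →
      ∃ G : Finset (X → ℝ), G.card = d ∧ (∀ g ∈ G, Measurable g ∧ ∀ x, |g x| ≤ b) ∧
        ∀ ghat : LqRegression.Estimator.{u, v} X n,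
        ∃ P : Measure (X × ℝ), IsProbabilityMeasure P ∧
          ∫⁻ z, ENNReal.ofReal (|z.2| ^ s) ∂P ≤ ENNReal.ofReal A ∧
          (∀ g ∈ G, LqRegression.risk q P g < ∞) ∧
          (⨅ g ∈ G, LqRegression.risk q P g) +
              ENNReal.ofReal (C * (min (Real.log d / n) 1) ^ (1 - (q - 1) / s))
            ≤ ghat.expectedRisk q P ∧
          (⨅ g ∈ G, LqRegression.risk q P g) +
              ENNReal.ofReal (C * (min (Real.log d / n) 1) ^ (1 - q / (s + 2)))
            ≤ ghat.expectedRisk q P := by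
  have hs0 : 0 < s := by linarith
  have hq0 : 0 < q := by linarith
  have he₁ : 0 < 1 - (q - 1) / s := by rw [sub_pos, div_lt_one hs0]; linarith
  have he₁' : 1 - (q - 1) / s ≤ 1 := sub_le_self _ (div_nonneg (by linarith) hs0.le)
  have he₂ : 0 < 1 - q / (s + 2) := by rw [sub_pos, div_lt_one (by linarith)]; linarith
  have he₂' : 1 - q / (s + 2) ≤ 1 := sub_le_self _ (by positivity)
  obtain ⟨C, hC, hdesign⟩ := LqRegression.exists_design hq hs hb hA
  refine ⟨C / 2, by positivity, fun d n hd hn X _ _ hX => ?_⟩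
  -- Room for at most `Nat.log 2 d` cells and the additional rest point.
  have hXlog : ((Nat.log 2 d + 1 : ℕ) : ℕ∞) ≤ ENat.card X := by
    rwa [mul_comm, Nat.log_mul_base one_lt_two (by omega)] at hX
  have hXne : Nonempty X := by
    rw [← ENat.one_le_card_iff_nonempty]
    exact le_trans (by exact_mod_cast Nat.le_add_left 1 _) hXlog
  rcases hd.eq_or_lt with rfl | hd2
  -- For d = 1 both rates vanish, since log 1 = 0 and the exponents are positive; a point mass on
  -- which the zero function has no risk suffices.
  · obtain ⟨x₀⟩ := hXne
    refine ⟨{fun _ => 0}, Finset.card_singleton _, ?_, fun e => ?_⟩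
    · intro g hg
      rw [Finset.mem_singleton.1 hg]
      exact ⟨measurable_const, fun _ => by simpa using hb.le⟩
    have hrisk : LqRegression.risk q (Measure.dirac ((x₀, 0) : X × ℝ)) (fun _ => 0) = 0 := by
      rw [LqRegression.risk, lintegral_dirac' _ (by fun_prop)]
      simp [Real.zero_rpow hq0.ne']
    refine ⟨Measure.dirac (x₀, 0), inferInstance, ?_, ?_, ?_, ?_⟩
    · rw [lintegral_dirac' _ (by fun_prop)]
      simp [Real.zero_rpow hs0.ne']
    · intro g hg
      rw [Finset.mem_singleton.1 hg, hrisk]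
      exact ENNReal.zero_lt_top
    · simp [hrisk, Real.zero_rpow he₁.ne']
    · simp [hrisk, Real.zero_rpow he₂.ne']
  -- The first bound gives 2^k ≤ d; the second gives k/n ≤ 1, as both designs require.
  set k := min (Nat.log 2 d) n with hk
  have hk1 : 1 ≤ k := le_min (Nat.log_pos one_lt_two hd2) hn
  obtain ⟨S, _, ε, ⟨D⟩, hε₁, hε₂⟩ := hdesign k n hk1 (min_le_right _ _)
  obtain ⟨pt, hpt⟩ := LqRegression.exists_injective_option_fin (X := X) (k := k)
    (le_trans (by exact_mod_cast Nat.succ_le_succ (min_le_left _ _)) hXlog)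
  have hvertex : ∀ σ : Fin k → Bool, ∃ g : X → ℝ, Measurable g ∧ (∀ x, |g x| ≤ b) ∧
      ∀ i : Option (Fin k), g (pt i) = i.elim 0 fun j => LqRegression.signed b (σ j) := by
    intro σ
    refine LqRegression.exists_measurable_bounded_extension hpt _ (fun i => ?_) hb.le
    cases i with
    | none => simpa using hb.le
    | some j => exact (LqRegression.abs_signed hb.le _).le
  choose f hf hfb hfpt using hvertex
  obtain ⟨G, hGd, hG, hfG⟩ := LqRegression.exists_finset_bounded_measurable f hb hf hfb (d := d) (by
    rw [Fintype.card_fun, Fintype.card_bool, Fintype.card_fin]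
    exact (Nat.pow_le_pow_right two_pos (min_le_left _ _)).trans
      (Nat.pow_log_le_self 2 (by omega)))
  refine ⟨G, hGd, hG, fun e => ?_⟩
  obtain ⟨P, hP, hmoment, hfin, σ, m, hm, hexcess⟩ := D.exists_law hq0 hs0 pt e
  have hinf : (⨅ g ∈ G, LqRegression.risk q P g) ≤ m :=
    (iInf₂_le (f σ) (hfG σ)).trans (hm _ (hf σ) (hfpt σ none) fun j => hfpt σ (some j))
  have hfinal : ∀ t, t ≤ ε →
      (⨅ g ∈ G, LqRegression.risk q P g) + ENNReal.ofReal t ≤ e.expectedRisk q P := fun t ht =>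
    (add_le_add hinf (ENNReal.ofReal_le_ofReal ht)).trans hexcess
  refine ⟨P, hP, hmoment, fun g hg => hfin g (hG g hg).1, hfinal _ (le_trans ?_ hε₁),
    hfinal _ (le_trans ?_ hε₂)⟩
  · have := mul_le_mul_of_nonneg_left
      (LqRegression.min_log_div_rpow_le (n := n) hd2 he₁.le he₁') (half_pos hC).le
    linarith
  · have := mul_le_mul_of_nonneg_left
      (LqRegression.min_log_div_rpow_le (n := n) hd2 he₂.le he₂') (half_pos hC).le
    linarith
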